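/- Let $d\in\{2,3\}$, let $\Omega\subset\mathbb{R}^d$ be a bounded open set (in particular, $\Omega$ may be any bounded polygonal or polyhedral domain with Lipschitz boundary), let $\varepsilon>0$ and $f\in L^2(\Omega)$. Write $(\cdot,\cdot)$ for the $L^2(\Omega)$ inner product, and let $H^m_0(\Omega)$ be the closure of $C_c^\infty(\Omega)$ in the Sobolev space $H^m(\Omega)$. Consider the primal weak formulation of $\varepsilon^2\Delta^2u-\Delta u=f$ in $\Omega$ with clamped boundary conditions $u=\partial u/\partial\mathbf{n}=0$ on $\partial\Omega$: find $\tilde u\in H^2_0(\Omega)$ such that $$\varepsilon^2(\Delta\tilde u,\Delta v)+(\nabla\tilde u,\nabla v)=(f,v)\qquad\forall v\in H^2_0(\Omega),$$ and the mixed weak formulation: find $(\psi,u)\in H^1(\Omega)\times H^1_0(\Omega)$ such that $$\varepsilon^2(\nabla\psi,\nabla\varphi)+(\psi,\varphi)=(f,\varphi)\quad\forall\varphi\in H^1_0(\Omega),\qquad (\nabla u,\nabla v)=(\psi,v)\quad\forall v\in H^1(\Omega).$$ Then the primal formulation has exactly one solution $\tilde u$, the mixed formulation has at most one solution $(\psi,u)$,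 and, whenever $(\psi,u)$ is a solution of the mixed formulation, $\tilde u=u$ (almost everywhere in $\Omega$) if and only if $u\in H^2_0(\Omega)$. -/

import Mathlib

open MeasureTheory Filter Topology
open scoped ContDiff ENNReal

noncomputable section

/-- Euclidean space `ℝ^d`. -/
abbrev Euc (d : ℕ) : Type := EuclideanSpace ℝ (Fin d)

/-- Lebesgue measure on `Ω`. -/
abbrev volOn {d : ℕ} (Ω : Set (Euc d)) : Measure (Euc d) := volume.restrict Ω

/-- The space `C_c^∞(Ω)` of test functions (extended by zero to the whole space). -/
def IsTestFunction {d : ℕ} (Ω : Set (Euc d)) (φ : Euc d → ℝ) : Prop :=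
  ContDiff ℝ ∞ φ ∧ HasCompactSupport φ ∧ tsupport φ ⊆ Ω

/-- The classical partial derivative `∂φ/∂x_i`. -/
def pderiv {d : ℕ} (i : Fin d) (φ : Euc d → ℝ) (x : Euc d) : ℝ :=
  fderiv ℝ φ x (EuclideanSpace.single i 1)

/-- `g ∈ L²(Ω)` is the weak partial derivative `∂u/∂x_i` on `Ω`. -/
def IsWeakPartial {d : ℕ} (Ω : Set (Euc d)) (i : Fin d) (u g : Euc d → ℝ) : Prop :=
  MemLp g 2 (volOn Ω) ∧ ∀ φ : Euc d → ℝ, IsTestFunction Ω φ →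
    ∫ x in Ω, u x * pderiv i φ x = - ∫ x in Ω, g x * φ x

open Classical in
/-- A representative of the weak partial derivative `∂u/∂x_i ∈ L²(Ω)` (and `0` if there is no
such derivative). It is unique up to sets of measure zero when `u ∈ L²(Ω)` and `Ω` is open. -/
def weakPartial {d : ℕ} (Ω : Set (Euc d)) (i : Fin d) (u : Euc d → ℝ) : Euc d → ℝ :=
  if h : ∃ g : Euc d → ℝ, IsWeakPartial Ω i u g then h.choose else 0

/-- `u ∈ H¹(Ω)`. -/
def MemH1 {d : ℕ} (Ω : Set (Euc d)) (u : Euc d → ℝ) : Prop :=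
  MemLp u 2 (volOn Ω) ∧ ∀ i : Fin d, ∃ g : Euc d → ℝ, IsWeakPartial Ω i u g

/-- `u ∈ H²(Ω)`. -/
def MemH2 {d : ℕ} (Ω : Set (Euc d)) (u : Euc d → ℝ) : Prop :=
  MemH1 Ω u ∧ ∀ i : Fin d, MemH1 Ω (weakPartial Ω i u)

/-- `u ∈ H¹₀(Ω)`, the closure of `C_c^∞(Ω)` in `H¹(Ω)`. -/
def MemH10 {d : ℕ} (Ω : Set (Euc d)) (u : Euc d → ℝ) : Prop :=
  MemH1 Ω u ∧ ∃ φ : ℕ → Euc d → ℝ, (∀ n, IsTestFunction Ω (φ n)) ∧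
    Tendsto (fun n => eLpNorm (fun x => u x - φ n x) 2 (volOn Ω)) atTop (𝓝 0) ∧
    ∀ i : Fin d, Tendsto
      (fun n => eLpNorm (fun x => weakPartial Ω i u x - pderiv i (φ n) x) 2 (volOn Ω))
      atTop (𝓝 0)

/-- `u ∈ H²₀(Ω)`, the closure of `C_c^∞(Ω)` in `H²(Ω)`. -/
def MemH20 {d : ℕ} (Ω : Set (Euc d)) (u : Euc d → ℝ) : Prop :=
  MemH2 Ω u ∧ ∃ φ : ℕ → Euc d → ℝ, (∀ n, IsTestFunction Ω (φ n)) ∧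
    Tendsto (fun n => eLpNorm (fun x => u x - φ n x) 2 (volOn Ω)) atTop (𝓝 0) ∧
    (∀ i : Fin d, Tendsto
      (fun n => eLpNorm (fun x => weakPartial Ω i u x - pderiv i (φ n) x) 2 (volOn Ω))
      atTop (𝓝 0)) ∧
    ∀ i j : Fin d, Tendsto
      (fun n => eLpNorm (fun x => weakPartial Ω j (weakPartial Ω i u) x
        - pderiv j (pderiv i (φ n)) x) 2 (volOn Ω))
      atTop (𝓝 0)

/-- The `L²(Ω)` inner product `(u, v)`. -/
def innerL2 {d : ℕ} (Ω : Set (Euc d)) (u v : Euc d → ℝ) : ℝ :=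
  ∫ x in Ω, u x * v x

/-- The inner product `(∇u, ∇v)` of the weak gradients. -/
def innerGrad {d : ℕ} (Ω : Set (Euc d)) (u v : Euc d → ℝ) : ℝ :=
  ∑ i : Fin d, innerL2 Ω (weakPartial Ω i u) (weakPartial Ω i v)

/-- The weak Laplacian `Δu` of `u ∈ H²(Ω)`. -/
def weakLaplacian {d : ℕ} (Ω : Set (Euc d)) (u : Euc d → ℝ) : Euc d → ℝ :=
  fun x => ∑ i : Fin d, weakPartial Ω i (weakPartial Ω i u) x

/-- `w ∈ H²₀(Ω)` solves the primal weak formulation of `ε²Δ²w - Δw = f` in `Ω`,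
`w = ∂w/∂n = 0` on the boundary. -/
def IsPrimalSolution {d : ℕ} (Ω : Set (Euc d)) (ε : ℝ) (f w : Euc d → ℝ) : Prop :=
  MemH20 Ω w ∧ ∀ v : Euc d → ℝ, MemH20 Ω v →
    ε ^ 2 * innerL2 Ω (weakLaplacian Ω w) (weakLaplacian Ω v) + innerGrad Ω w v = innerL2 Ω f v

/-- `(ψ, u) ∈ H¹(Ω) × H¹₀(Ω)` solves the mixed weak formulation of `-ε²Δψ + ψ = f`, `-Δu = ψ`
in `Ω`, `u = ∂u/∂n = 0` on the boundary. -/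
def IsMixedSolution {d : ℕ} (Ω : Set (Euc d)) (ε : ℝ) (f ψ u : Euc d → ℝ) : Prop :=
  MemH1 Ω ψ ∧ MemH10 Ω u ∧
    (∀ φ : Euc d → ℝ, MemH10 Ω φ →
      ε ^ 2 * innerGrad Ω ψ φ + innerL2 Ω ψ φ = innerL2 Ω f φ) ∧
    ∀ v : Euc d → ℝ, MemH1 Ω v → innerGrad Ω u v = innerL2 Ω ψ v

end

/-! The primal problem is solved by Lax–Milgram on $H^2_0(\Omega)$. For a test function, two
integrations by parts give
$\|\partial_j\partial_i\varphi\|^2=(\partial_i^2\varphi,\partial_j^2\varphi)$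
(`innerL2_pderiv_pderiv`). Summed over $i,j$, this says that the Hessian and the Laplacian have the
same norm. With the Poincaré inequality (`innerL2_self_le_pderiv`) it makes the bilinear form
coercive (`energyForm_coercive`). To work in a Hilbert space, a function is replaced by the family
of its derivatives, and $H^m_0(\Omega)$ becomes a closed subspace `sobolevJets` of a finite product
of copies of $L^2(\Omega)$. Facts about test functions pass to it by density.

For the mixed problem, let $(P,U)$ be the difference of two solutions. Testing the first equation
with $U$ and the second with $P$ and with $U$ gives $\varepsilon^2\|P\|^2+\|\nabla U\|^2=0$, so
$P=0$, and $U=0$ by Poincaré.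

If $u\in H^2_0(\Omega)$, the second mixed equation says $\psi=-\Delta u$, and Green's formula
(`innerL2_weakLaplacian`) turns the first one, tested on $H^2_0\subset H^1_0$, into the primal
equation. Primal uniqueness then gives $\tilde u=u$. The converse holds because $\tilde u\in
H^2_0(\Omega)$ and membership depends only on the a.e. class. -/

/-! ### Calculus and integral inequalities for test functions. -/

section TestFunctions

variable {d : ℕ} {Ω : Set (Euc d)}

namespace IsTestFunction

variable {φ η : Euc d → ℝ}

theorem eq_zero (hφ : IsTestFunction Ω φ) {x : Euc d} (hx : x ∉ Ω) : φ x = 0 :=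
  image_eq_zero_of_notMem_tsupport fun h => hx (hφ.2.2 h)

theorem continuous (hφ : IsTestFunction Ω φ) : Continuous φ := hφ.1.continuous

theorem differentiable (hφ : IsTestFunction Ω φ) : Differentiable ℝ φ :=
  hφ.1.differentiable (by simp)

theorem memLp (hφ : IsTestFunction Ω φ) (p : ℝ≥0∞) : MemLp φ p (volOn Ω) :=
  hφ.continuous.memLp_of_hasCompactSupport hφ.2.1

theorem zero : IsTestFunction Ω (0 : Euc d → ℝ) :=
  ⟨contDiff_const, HasCompactSupport.zero, by simp [tsupport]⟩

theorem add (hφ : IsTestFunction Ω φ) (hη : IsTestFunction Ω η) : IsTestFunction Ω (φ + η) :=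
  ⟨hφ.1.add hη.1, hφ.2.1.add hη.2.1,
    (tsupport_add φ η).trans (Set.union_subset hφ.2.2 hη.2.2)⟩

theorem const_smul (hφ : IsTestFunction Ω φ) (c : ℝ) : IsTestFunction Ω (c • φ) :=
  ⟨hφ.1.const_smul c, hφ.2.1.smul_left (f := fun _ => c),
    (tsupport_smul_subset_right (fun _ => c) φ).trans hφ.2.2⟩

theorem pderiv (hφ : IsTestFunction Ω φ) (i : Fin d) : IsTestFunction Ω (pderiv i φ) :=
  ⟨(hφ.1.fderiv_right (by simp)).clm_apply contDiff_const, hφ.2.1.fderiv_apply ℝ _,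
    (tsupport_fderiv_apply_subset ℝ _).trans hφ.2.2⟩

theorem integrable_mul (hφ : IsTestFunction Ω φ) {g : Euc d → ℝ} (hg : Continuous g) :
    Integrable (fun x => g x * φ x) :=
  (hg.mul hφ.continuous).integrable_of_hasCompactSupport hφ.2.1.mul_left

theorem setIntegral_mul (hφ : IsTestFunction Ω φ) (g : Euc d → ℝ) :
    ∫ x in Ω, g x * φ x = ∫ x, g x * φ x :=
  setIntegral_eq_integral_of_forall_compl_eq_zero fun x hx => by rw [hφ.eq_zero hx, mul_zero]

end IsTestFunction

theorem pderiv_add {φ η : Euc d → ℝ} (hφ : Differentiable ℝ φ) (hη : Differentiable ℝ η)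
    (i : Fin d) : pderiv i (φ + η) = pderiv i φ + pderiv i η := by
  ext x
  simp [pderiv, fderiv_add (hφ x) (hη x)]

theorem pderiv_const_smul {φ : Euc d → ℝ} (hφ : Differentiable ℝ φ) (c : ℝ) (i : Fin d) :
    pderiv i (c • φ) = c • pderiv i φ := by
  ext x
  simp [pderiv, fderiv_const_smul (hφ x)]

theorem pderiv_comm {φ : Euc d → ℝ} (hφ : ContDiff ℝ ∞ φ) (i j : Fin d) :
    pderiv i (pderiv j φ) = pderiv j (pderiv i φ) := by
  ext x
  have hd : DifferentiableAt ℝ (fderiv ℝ φ) x :=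
    ((hφ.fderiv_right (m := ∞) (by simp)).differentiable (by simp)) x
  have key : ∀ k l : Fin d, pderiv k (pderiv l φ) x =
      fderiv ℝ (fderiv ℝ φ) x (EuclideanSpace.single k 1) (EuclideanSpace.single l 1) := by
    intro k l
    unfold pderiv
    rw [fderiv_clm_apply hd (differentiableAt_const _)]
    simp
  rw [key, key]
  refine hφ.contDiffAt.isSymmSndFDerivAt ?_ _ _
  rw [minSmoothness_of_isRCLikeNormedField]
  exact WithTop.coe_le_coe.2 (le_top : (2 : ℕ∞) ≤ ⊤)

/-- Integration by parts against a test function. -/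
theorem integral_mul_pderiv {u φ : Euc d → ℝ} (hu : ContDiff ℝ ∞ u) (hφ : IsTestFunction Ω φ)
    (i : Fin d) : ∫ x in Ω, u x * pderiv i φ x = - ∫ x in Ω, pderiv i u x * φ x := by
  rw [(hφ.pderiv i).setIntegral_mul, hφ.setIntegral_mul]
  have hc : Continuous (pderiv i u) :=
    ((hu.fderiv_right (m := ∞) (by simp)).clm_apply contDiff_const).continuous
  exact integral_mul_fderiv_eq_neg_fderiv_mul_of_integrable (hφ.integrable_mul hc)
    ((hφ.pderiv i).integrable_mul hu.continuous) (hφ.integrable_mul hu.continuous)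
    (fun x _ => hu.differentiable (by simp) x) (fun x _ => hφ.differentiable x)

/-- The Poincaré inequality for test functions, on a domain between two hyperplanes. -/
theorem innerL2_self_le_pderiv {φ : Euc d → ℝ} (hφ : IsTestFunction Ω φ) (i : Fin d) {R : ℝ}
    (hR : ∀ x ∈ Ω, |x i| ≤ R) :
    innerL2 Ω φ φ ≤ 4 * R ^ 2 * innerL2 Ω (pderiv i φ) (pderiv i φ) := by
  have hx : ContDiff ℝ ∞ (fun x : Euc d => x i) := contDiff_piLp_apply 2
  have hφ2 : IsTestFunction Ω (fun x => φ x * φ x) :=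
    ⟨hφ.1.mul hφ.1, hφ.2.1.mul_left, (tsupport_mul_subset_left).trans hφ.2.2⟩
  -- Since $\partial_i x_i=1$, integrating by parts yields $\int\varphi^2=-\int
  -- x_i\,\partial_i(\varphi^2)$.
  have h1 := integral_mul_pderiv hx hφ2 i
  have e1 : ∀ x, pderiv i (fun x : Euc d => x i) x = 1 := by
    intro x
    have : (fun x : Euc d => x i) = (EuclideanSpace.proj i : Euc d →L[ℝ] ℝ) := rfl
    simp only [pderiv, this, ContinuousLinearMap.fderiv]
    simp
  have e2 : ∀ x, pderiv i (fun x => φ x * φ x) x = 2 * (pderiv i φ x * φ x) := by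
    intro x
    simp only [pderiv]
    rw [fderiv_fun_mul (hφ.differentiable x) (hφ.differentiable x)]
    simp; ring
  simp only [e1, e2, one_mul] at h1
  have i1 : Integrable (fun x => φ x * φ x) (volOn Ω) :=
    (hφ.integrable_mul hφ.continuous).integrableOn
  have i2 : Integrable (fun x => pderiv i φ x * pderiv i φ x) (volOn Ω) :=
    ((hφ.pderiv i).integrable_mul (hφ.pderiv i).continuous).integrableOn
  have i3 : Integrable (fun x : Euc d => x i * (2 * (pderiv i φ x * φ x))) (volOn Ω) := by
    have := (hφ.integrable_mul (g := fun x => x i * 2 * pderiv i φ x)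
      ((hx.continuous.mul continuous_const).mul (hφ.pderiv i).continuous)).integrableOn (s := Ω)
    refine this.congr (ae_of_all _ fun x => ?_)
    simp only; ring
  -- Young's inequality
  -- $-2x_i\varphi\,\partial_i\varphi\le\frac12\varphi^2+2x_i^2(\partial_i\varphi)^2$. The term
  -- $\frac12\int\varphi^2$ is absorbed on the left, whence the constant $4R^2$.
  have h2 : - ∫ x in Ω, x i * (2 * (pderiv i φ x * φ x)) ≤
      ∫ x in Ω, ((1 / 2) * (φ x * φ x) + 2 * R ^ 2 * (pderiv i φ x * pderiv i φ x)) := by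
    rw [← integral_neg]
    refine integral_mono i3.neg ((i1.const_mul _).add (i2.const_mul _)) fun x => ?_
    by_cases hxΩ : x ∈ Ω
    · have h := hR x hxΩ
      have h' : x i ^ 2 ≤ R ^ 2 := sq_le_sq' (abs_le.1 h).1 (abs_le.1 h).2
      have := mul_le_mul_of_nonneg_right h' (sq_nonneg (pderiv i φ x))
      simp only
      nlinarith [sq_nonneg (φ x + 2 * x i * pderiv i φ x)]
    · simp [hφ.eq_zero hxΩ, (hφ.pderiv i).eq_zero hxΩ]
  rw [integral_add (i1.const_mul _) (i2.const_mul _), integral_const_mul, integral_const_mul] at h2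
  unfold innerL2
  linarith

/-- The mixed second derivatives of a test function are controlled by its Laplacian. -/
theorem innerL2_pderiv_pderiv {φ : Euc d → ℝ} (hφ : IsTestFunction Ω φ) (i j : Fin d) :
    innerL2 Ω (pderiv j (pderiv i φ)) (pderiv j (pderiv i φ)) =
      innerL2 Ω (pderiv i (pderiv i φ)) (pderiv j (pderiv j φ)) := by
  -- Both sides equal $-\int\partial_i\partial_j^2\varphi\,\partial_i\varphi$, once third
  -- derivatives are commuted.
  have h1 := integral_mul_pderiv ((hφ.pderiv i).pderiv j).1 (hφ.pderiv i) j
  have h2 := integral_mul_pderiv ((hφ.pderiv j).pderiv j).1 (hφ.pderiv i) i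
  have e : pderiv j (pderiv j (pderiv i φ)) = pderiv i (pderiv j (pderiv j φ)) := by
    rw [pderiv_comm hφ.1 j i, pderiv_comm (hφ.pderiv j).1 j i]
  unfold innerL2
  rw [h1, e, ← h2]
  simp only [mul_comm]

end TestFunctions

/-! ### Weak derivatives and almost everywhere classes. -/

section WeakDerivatives

variable {d : ℕ} {Ω : Set (Euc d)}

theorem innerL2_congr {u u' v v' : Euc d → ℝ} (hu : u =ᵐ[volOn Ω] u') (hv : v =ᵐ[volOn Ω] v') :
    innerL2 Ω u v = innerL2 Ω u' v' :=
  integral_congr_ae (hu.mul hv)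

theorem innerL2_coe (x y : Lp ℝ 2 (volOn Ω)) : innerL2 Ω x y = inner ℝ x y := by
  rw [L2.inner_def]
  simp [innerL2, mul_comm]

theorem innerL2_eq_inner {u v : Euc d → ℝ} {x y : Lp ℝ 2 (volOn Ω)} (hu : u =ᵐ[volOn Ω] x)
    (hv : v =ᵐ[volOn Ω] y) : innerL2 Ω u v = inner ℝ x y := by
  rw [innerL2_congr hu hv, innerL2_coe]

theorem tendsto_toLp {u : Euc d → ℝ} {φ : ℕ → Euc d → ℝ} (x : Lp ℝ 2 (volOn Ω))
    (hx : u =ᵐ[volOn Ω] x) (hφ : ∀ n, MemLp (φ n) 2 (volOn Ω)) :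
    Tendsto (fun n => (hφ n).toLp (φ n)) atTop (𝓝 x) ↔
      Tendsto (fun n => eLpNorm (fun y => u y - φ n y) 2 (volOn Ω)) atTop (𝓝 0) := by
  rw [Lp.tendsto_Lp_iff_tendsto_eLpNorm']
  refine tendsto_congr fun n => ?_
  rw [eLpNorm_sub_comm]
  refine eLpNorm_congr_ae ?_
  filter_upwards [hx, (hφ n).coeFn_toLp] with y h1 h2
  simp [h1, h2]

/-- The fundamental lemma of the calculus of variations in `L²(Ω)`. -/
theorem ae_eq_of_forall_innerL2 (hΩ : IsOpen Ω) {g g' : Euc d → ℝ}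
    (hg : MemLp g 2 (volOn Ω)) (hg' : MemLp g' 2 (volOn Ω))
    (h : ∀ φ, IsTestFunction Ω φ → innerL2 Ω g φ = innerL2 Ω g' φ) : g =ᵐ[volOn Ω] g' := by
  have hloc : LocallyIntegrableOn (fun x => g x - g' x) Ω volume :=
    locallyIntegrableOn_of_locallyIntegrable_restrict
      ((hg.sub hg').locallyIntegrable (by norm_num))
  have := hΩ.ae_eq_zero_of_integral_contDiff_smul_eq_zero hloc fun φ h1 h2 h3 => by
    have hφ : IsTestFunction Ω φ := ⟨h1, h2, h3⟩
    have e := h φ hφ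
    unfold innerL2 at e
    have i1 : Integrable (fun x => g x * φ x) (volOn Ω) := hg.integrable_mul (hφ.memLp 2)
    have i2 : Integrable (fun x => g' x * φ x) (volOn Ω) := hg'.integrable_mul (hφ.memLp 2)
    calc ∫ x, φ x • (g x - g' x) = ∫ x, (g x - g' x) * φ x := by simp only [smul_eq_mul, mul_comm]
      _ = ∫ x in Ω, (g x - g' x) * φ x := (hφ.setIntegral_mul (fun x => g x - g' x)).symm
      _ = 0 := by
        simp only [sub_mul]
        rw [integral_sub i1 i2, e, sub_self]
  refine (ae_restrict_iff' hΩ.measurableSet).2 ?_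
  filter_upwards [this] with x hx hxΩ using sub_eq_zero.1 (hx hxΩ)

theorem isWeakPartial_congr {u u' : Euc d → ℝ} (h : u =ᵐ[volOn Ω] u') (i : Fin d) :
    IsWeakPartial Ω i u = IsWeakPartial Ω i u' := by
  funext g
  have : ∀ φ : Euc d → ℝ, ∫ x in Ω, u x * pderiv i φ x = ∫ x in Ω, u' x * pderiv i φ x :=
    fun φ => innerL2_congr h ae_eq_rfl
  simp only [IsWeakPartial, this]

/-- The chosen representative depends on `u` only through the predicate `IsWeakPartial Ω i u`, which
is the same for a.e. equal functions. Hence the equality is literal and allows rewriting inside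
iterated weak derivatives. -/
theorem weakPartial_congr {u u' : Euc d → ℝ} (h : u =ᵐ[volOn Ω] u') (i : Fin d) :
    weakPartial Ω i u = weakPartial Ω i u' := by
  unfold weakPartial
  rw [isWeakPartial_congr h i]

theorem isWeakPartial_weakPartial {u : Euc d → ℝ} {i : Fin d}
    (h : ∃ g, IsWeakPartial Ω i u g) : IsWeakPartial Ω i u (weakPartial Ω i u) := by
  rw [weakPartial, dif_pos h]
  exact h.choose_spec

theorem IsWeakPartial.weakPartial_ae_eq (hΩ : IsOpen Ω) {u g : Euc d → ℝ} {i : Fin d}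
    (h : IsWeakPartial Ω i u g) : weakPartial Ω i u =ᵐ[volOn Ω] g := by
  have h' := isWeakPartial_weakPartial ⟨g, h⟩
  refine ae_eq_of_forall_innerL2 hΩ h'.1 h.1 fun φ hφ => ?_
  exact neg_injective ((h'.2 φ hφ).symm.trans (h.2 φ hφ))

theorem MemH1.congr {u u' : Euc d → ℝ} (hu : MemH1 Ω u) (h : u =ᵐ[volOn Ω] u') : MemH1 Ω u' :=
  ⟨(memLp_congr_ae h).1 hu.1, fun i => isWeakPartial_congr h i ▸ hu.2 i⟩

theorem MemH20.congr {u u' : Euc d → ℝ} (hu : MemH20 Ω u) (h : u =ᵐ[volOn Ω] u') :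
    MemH20 Ω u' := by
  obtain ⟨⟨h1, h2⟩, φ, hφ, t0, t1, t2⟩ := hu
  simp only [weakPartial_congr h] at h2 t1 t2
  refine ⟨⟨h1.congr h, h2⟩, φ, hφ, t0.congr fun n => eLpNorm_congr_ae ?_, t1, t2⟩
  filter_upwards [h] with x hx
  rw [hx]

theorem MemH20.memH10 {u : Euc d → ℝ} (hu : MemH20 Ω u) : MemH10 Ω u :=
  let ⟨h, φ, hφ, t0, t1, _⟩ := hu
  ⟨h.1, φ, hφ, t0, t1⟩

theorem IsTestFunction.isWeakPartial {φ : Euc d → ℝ} (hφ : IsTestFunction Ω φ) (i : Fin d) :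
    IsWeakPartial Ω i φ (_root_.pderiv i φ) :=
  ⟨(hφ.pderiv i).memLp 2, fun _ hη => integral_mul_pderiv hφ.1 hη i⟩

theorem IsTestFunction.memH1 {φ : Euc d → ℝ} (hφ : IsTestFunction Ω φ) : MemH1 Ω φ :=
  ⟨hφ.memLp 2, fun i => ⟨_, hφ.isWeakPartial i⟩⟩

end WeakDerivatives

/-! ### Families of derivatives and the closure of the test functions. -/

section Jets

variable {d : ℕ} {Ω : Set (Euc d)} {ι : Type*}

/-- The iterated classical partial derivative along a list of directions. -/
noncomputable def iterPderiv : List (Fin d) → (Euc d → ℝ) → Euc d → ℝ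
  | [], φ => φ
  | i :: l, φ => pderiv i (iterPderiv l φ)

/-- The iterated weak partial derivative along a list of directions. -/
noncomputable def iterWeakPartial (Ω : Set (Euc d)) : List (Fin d) → (Euc d → ℝ) → Euc d → ℝ
  | [], u => u
  | i :: l, u => weakPartial Ω i (iterWeakPartial Ω l u)

theorem IsTestFunction.iterPderiv {φ : Euc d → ℝ} (hφ : IsTestFunction Ω φ) :
    ∀ l : List (Fin d), IsTestFunction Ω (iterPderiv l φ)
  | [] => hφ
  | i :: l => (hφ.iterPderiv l).pderiv i

theorem iterPderiv_add {φ η : Euc d → ℝ} (hφ : IsTestFunction Ω φ) (hη : IsTestFunction Ω η) :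
    ∀ l : List (Fin d), iterPderiv l (φ + η) = iterPderiv l φ + iterPderiv l η
  | [] => rfl
  | i :: l => by
    simp only [iterPderiv]
    rw [iterPderiv_add hφ hη l,
      pderiv_add (hφ.iterPderiv l).differentiable (hη.iterPderiv l).differentiable]

theorem iterPderiv_const_smul {φ : Euc d → ℝ} (hφ : IsTestFunction Ω φ) (c : ℝ) :
    ∀ l : List (Fin d), iterPderiv l (c • φ) = c • iterPderiv l φ
  | [] => rfl
  | i :: l => by
    simp only [iterPderiv]
    rw [iterPderiv_const_smul hφ c l, pderiv_const_smul (hφ.iterPderiv l).differentiable]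

/-- Families in `L²(Ω)`, indexed by `ι`. -/
abbrev L2Family (Ω : Set (Euc d)) (ι : Type*) : Type _ := PiLp 2 fun _ : ι => Lp ℝ 2 (volOn Ω)

/-- The families of derivatives, along the multi-indices `m k`, of the test functions. -/
noncomputable def testJets (Ω : Set (Euc d)) (m : ι → List (Fin d)) : Submodule ℝ (L2Family Ω ι) where
  carrier := {x | ∃ φ, IsTestFunction Ω φ ∧ ∀ k, x k =ᵐ[volOn Ω] iterPderiv (m k) φ}
  zero_mem' := ⟨0, IsTestFunction.zero, fun k => by
    -- Homogeneity with factor `0` shows that the derivatives of the zero function vanish.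
    have h := iterPderiv_const_smul (IsTestFunction.zero (Ω := Ω)) 0 (m k)
    rw [zero_smul, zero_smul] at h
    rw [h]
    exact Lp.coeFn_zero _ _ _⟩
  add_mem' := by
    rintro x y ⟨φ, hφ, hx⟩ ⟨η, hη, hy⟩
    refine ⟨φ + η, hφ.add hη, fun k => ?_⟩
    rw [iterPderiv_add hφ hη]
    exact (Lp.coeFn_add _ _).trans ((hx k).add (hy k))
  smul_mem' := by
    rintro c x ⟨φ, hφ, hx⟩
    refine ⟨c • φ, hφ.const_smul c, fun k => ?_⟩
    rw [iterPderiv_const_smul hφ]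
    exact (Lp.coeFn_smul _ _).trans ((hx k).const_smul c)

theorem continuous_L2Family_apply (k : ι) : Continuous fun x : L2Family Ω ι => x k :=
  (PiLp.proj 2 (𝕜 := ℝ) (fun _ : ι => Lp ℝ 2 (volOn Ω)) k).continuous

/-- The family of the iterated weak derivatives of `u` along the multi-indices `m k`. -/
noncomputable def weakJet (m : ι → List (Fin d)) (u : Euc d → ℝ)
    (h : ∀ k, MemLp (iterWeakPartial Ω (m k) u) 2 (volOn Ω)) : L2Family Ω ι :=
  WithLp.toLp 2 fun k => (h k).toLp (iterWeakPartial Ω (m k) u)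

theorem weakJet_ae_eq {m : ι → List (Fin d)} {u : Euc d → ℝ}
    (h : ∀ k, MemLp (iterWeakPartial Ω (m k) u) 2 (volOn Ω)) (k : ι) :
    weakJet m u h k =ᵐ[volOn Ω] iterWeakPartial Ω (m k) u :=
  (h k).coeFn_toLp

variable [Fintype ι]

/-- The closure of the jets of test functions: the Sobolev space "with zero boundary values". -/
noncomputable def sobolevJets (Ω : Set (Euc d)) (m : ι → List (Fin d)) : Submodule ℝ (L2Family Ω ι) :=
  (testJets Ω m).topologicalClosure

theorem mem_sobolevJets_iff {m : ι → List (Fin d)} {x : L2Family Ω ι} :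
    x ∈ sobolevJets Ω m ↔ ∃ φ : ℕ → Euc d → ℝ, (∀ n, IsTestFunction Ω (φ n)) ∧
      ∀ k, Tendsto (fun n => eLpNorm (fun y => x k y - iterPderiv (m k) (φ n) y) 2 (volOn Ω))
        atTop (𝓝 0) := by
  have key : ∀ φ : ℕ → Euc d → ℝ, ∀ hφ : ∀ n, IsTestFunction Ω (φ n),
      Tendsto (fun n => (WithLp.toLp 2 fun k =>
        (((hφ n).iterPderiv (m k)).memLp 2).toLp (iterPderiv (m k) (φ n)) : L2Family Ω ι))
        atTop (𝓝 x) ↔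
      ∀ k, Tendsto (fun n => eLpNorm (fun y => x k y - iterPderiv (m k) (φ n) y) 2 (volOn Ω))
        atTop (𝓝 0) := by
    intro φ hφ
    rw [(PiLp.homeomorph 2 (fun _ : ι => Lp ℝ 2 (volOn Ω))).isInducing.tendsto_nhds_iff,
      tendsto_pi_nhds]
    refine forall_congr' fun k => ?_
    exact tendsto_toLp (x k) ae_eq_rfl fun n => ((hφ n).iterPderiv (m k)).memLp 2
  rw [sobolevJets, ← SetLike.mem_coe, Submodule.topologicalClosure_coe,
    mem_closure_iff_seq_limit]
  constructor
  · rintro ⟨X, hX, hlim⟩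
    choose φ hφ hXφ using hX
    refine ⟨φ, hφ, (key φ hφ).1 ?_⟩
    convert hlim using 2 with n
    ext1 k
    exact Lp.ext ((MemLp.coeFn_toLp (((hφ n).iterPderiv (m k)).memLp 2)).trans (hXφ n k).symm)
  · rintro ⟨φ, hφ, h⟩
    exact ⟨_, fun n =>
      ⟨φ n, hφ n, fun k => MemLp.coeFn_toLp (((hφ n).iterPderiv (m k)).memLp 2)⟩, (key φ hφ).2 h⟩

/-- Density argument: identities and inequalities that are classical for test functions and
continuous in the jet extend to the closure. -/
theorem sobolevJets_induction {m : ι → List (Fin d)} {p : L2Family Ω ι → Prop}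
    (hp : IsClosed {x | p x})
    (h : ∀ x φ, IsTestFunction Ω φ → (∀ k, x k =ᵐ[volOn Ω] iterPderiv (m k) φ) → p x)
    {x : L2Family Ω ι} (hx : x ∈ sobolevJets Ω m) : p x := by
  have : closure (testJets Ω m : Set (L2Family Ω ι)) ⊆ {x | p x} :=
    closure_minimal (fun y ⟨φ, hφ, hy⟩ => h y φ hφ hy) hp
  exact this hx

/-- A limit of derivatives is a weak derivative of the limit. -/
theorem isWeakPartial_of_mem_sobolevJets {m : ι → List (Fin d)} {x : L2Family Ω ι}
    (hx : x ∈ sobolevJets Ω m) {k k' : ι} {i : Fin d} (hk : m k' = i :: m k) :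
    IsWeakPartial Ω i (x k) (x k') := by
  refine ⟨Lp.memLp _, fun η hη => ?_⟩
  have h1 := (((hη.pderiv i).memLp 2).coeFn_toLp).symm
  have h2 := ((hη.memLp 2).coeFn_toLp).symm
  change innerL2 Ω _ _ = - innerL2 Ω _ _
  refine sobolevJets_induction (p := fun x => innerL2 Ω (x k) (pderiv i η) = - innerL2 Ω (x k') η)
    ?_ (fun x φ hφ hxφ => ?_) hx
  · simp only [innerL2_eq_inner ae_eq_rfl h1, innerL2_eq_inner ae_eq_rfl h2]
    exact isClosed_eq ((continuous_L2Family_apply k).inner continuous_const)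
      ((continuous_L2Family_apply k').inner continuous_const).neg
  · rw [innerL2_congr (hxφ k) ae_eq_rfl, innerL2_congr (hxφ k') ae_eq_rfl, hk]
    exact integral_mul_pderiv (hφ.iterPderiv (m k)).1 hη i

theorem weakJet_mem_sobolevJets {m : ι → List (Fin d)} {u : Euc d → ℝ}
    (h : ∀ k, MemLp (iterWeakPartial Ω (m k) u) 2 (volOn Ω)) {φ : ℕ → Euc d → ℝ}
    (hφ : ∀ n, IsTestFunction Ω (φ n))
    (ht : ∀ k, Tendsto (fun n => eLpNorm (fun y => iterWeakPartial Ω (m k) u y -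
      iterPderiv (m k) (φ n) y) 2 (volOn Ω)) atTop (𝓝 0)) :
    weakJet m u h ∈ sobolevJets Ω m := by
  refine mem_sobolevJets_iff.2 ⟨φ, hφ, fun k => (ht k).congr fun n => eLpNorm_congr_ae ?_⟩
  filter_upwards [weakJet_ae_eq h k] with y hy
  rw [hy]

/-- The Poincaré inequality. -/
theorem inner_self_le_of_mem_sobolevJets {m : ι → List (Fin d)} {x : L2Family Ω ι}
    (hx : x ∈ sobolevJets Ω m) {k k' : ι} {i : Fin d} (hk : m k = []) (hk' : m k' = [i])
    {R : ℝ} (hR : ∀ x ∈ Ω, |x i| ≤ R) : ‖x k‖ ^ 2 ≤ 4 * R ^ 2 * ‖x k'‖ ^ 2 := by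
  refine sobolevJets_induction (p := fun x => ‖x k‖ ^ 2 ≤ 4 * R ^ 2 * ‖x k'‖ ^ 2)
    ?_ (fun x φ hφ hxφ => ?_) hx
  · exact isClosed_le ((continuous_L2Family_apply k).norm.pow 2)
      (continuous_const.mul ((continuous_L2Family_apply k').norm.pow 2))
  · rw [← real_inner_self_eq_norm_sq, ← real_inner_self_eq_norm_sq, ← innerL2_coe, ← innerL2_coe,
      innerL2_congr (hxφ k) (hxφ k), innerL2_congr (hxφ k') (hxφ k'), hk, hk']
    exact innerL2_self_le_pderiv hφ i hR

end Jets

/-! ### Identification of $H^1_0$ and $H^2_0$ functions with jets. -/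

section SobolevSpaces

variable {d : ℕ} {Ω : Set (Euc d)}

/-- Multi-indices of order at most one. -/
def firstOrder : Option (Fin d) → List (Fin d)
  | none => []
  | some i => [i]

/-- Multi-indices of order at most two. -/
def secondOrder : Option (Fin d ⊕ Fin d × Fin d) → List (Fin d)
  | none => []
  | some (.inl i) => [i]
  | some (.inr (i, j)) => [j, i]

theorem MemH1.memLp {u : Euc d → ℝ} (hu : MemH1 Ω u) :
    ∀ k, MemLp (iterWeakPartial Ω (firstOrder k) u) 2 (volOn Ω)
  | none => hu.1
  | some i => (isWeakPartial_weakPartial (hu.2 i)).1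

theorem MemH2.memLp {u : Euc d → ℝ} (hu : MemH2 Ω u) :
    ∀ k, MemLp (iterWeakPartial Ω (secondOrder k) u) 2 (volOn Ω)
  | none => hu.1.1
  | some (.inl i) => (hu.2 i).1
  | some (.inr (i, j)) => (isWeakPartial_weakPartial ((hu.2 i).2 j)).1

theorem MemH10.weakJet_mem {u : Euc d → ℝ} (hu : MemH10 Ω u) :
    weakJet firstOrder u hu.1.memLp ∈ sobolevJets Ω firstOrder := by
  obtain ⟨h, φ, hφ, t0, t1⟩ := hu
  refine weakJet_mem_sobolevJets _ hφ ?_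
  rintro (_ | i)
  exacts [t0, t1 i]

theorem MemH20.weakJet_mem {u : Euc d → ℝ} (hu : MemH20 Ω u) :
    weakJet secondOrder u hu.1.memLp ∈ sobolevJets Ω secondOrder := by
  obtain ⟨h, φ, hφ, t0, t1, t2⟩ := hu
  refine weakJet_mem_sobolevJets _ hφ ?_
  rintro (_ | i | ⟨i, j⟩)
  exacts [t0, t1 i, t2 i j]

theorem iterWeakPartial_ae_eq_of_mem_sobolevJets (hΩ : IsOpen Ω)
    {x : L2Family Ω (Option (Fin d ⊕ Fin d × Fin d))} (hx : x ∈ sobolevJets Ω secondOrder) :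
    ∀ k, x k =ᵐ[volOn Ω] iterWeakPartial Ω (secondOrder k) (x none)
  | none => ae_eq_rfl
  | some (.inl i) => ((isWeakPartial_of_mem_sobolevJets hx rfl).weakPartial_ae_eq hΩ).symm
  | some (.inr (i, j)) => by
    have h1 : weakPartial Ω i (x none) =ᵐ[volOn Ω] x (some (.inl i)) :=
      (isWeakPartial_of_mem_sobolevJets hx rfl).weakPartial_ae_eq hΩ
    change _ =ᵐ[volOn Ω] weakPartial Ω j (weakPartial Ω i (x none))
    rw [weakPartial_congr h1]
    exact ((isWeakPartial_of_mem_sobolevJets hx rfl).weakPartial_ae_eq hΩ).symm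

/-- Converse of `MemH20.weakJet_mem`: the components of a limit jet are weak derivatives of its
zeroth component, so Lax–Milgram on jets returns an actual function. -/
theorem memH20_of_mem_sobolevJets (hΩ : IsOpen Ω)
    {x : L2Family Ω (Option (Fin d ⊕ Fin d × Fin d))} (hx : x ∈ sobolevJets Ω secondOrder) :
    MemH20 Ω (x none) := by
  have h1 : ∀ i, IsWeakPartial Ω i (x none) (x (some (.inl i))) := fun i =>
    isWeakPartial_of_mem_sobolevJets hx rfl
  have h2 : ∀ i j, IsWeakPartial Ω j (x (some (.inl i))) (x (some (.inr (i, j)))) := fun i j =>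
    isWeakPartial_of_mem_sobolevJets hx rfl
  have hx' := iterWeakPartial_ae_eq_of_mem_sobolevJets hΩ hx
  obtain ⟨φ, hφ, ht⟩ := mem_sobolevJets_iff.1 hx
  have ht' : ∀ k, Tendsto (fun n => eLpNorm (fun y =>
      iterWeakPartial Ω (secondOrder k) (x none) y - iterPderiv (secondOrder k) (φ n) y) 2
      (volOn Ω)) atTop (𝓝 0) := fun k => (ht k).congr fun n => eLpNorm_congr_ae <| by
    filter_upwards [hx' k] with y hy
    rw [hy]
  refine ⟨⟨⟨Lp.memLp _, fun i => ⟨_, h1 i⟩⟩, fun i => MemH1.congr ⟨Lp.memLp _, fun j =>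
    ⟨_, h2 i j⟩⟩ (hx' (some (.inl i)))⟩, φ, hφ, ht' none, fun i => ht' (some (.inl i)),
    fun i j => ht' (some (.inr (i, j)))⟩

end SobolevSpaces

/-! ### Coercivity and well-posedness of the primal problem. -/

section Energy

variable {d : ℕ} {Ω : Set (Euc d)}

/-- The Laplacian on second order jets. -/
noncomputable def jetLaplacian (Ω : Set (Euc d)) :
    L2Family Ω (Option (Fin d ⊕ Fin d × Fin d)) →L[ℝ] Lp ℝ 2 (volOn Ω) :=
  ∑ i, PiLp.proj 2 (𝕜 := ℝ) (fun _ => Lp ℝ 2 (volOn Ω)) (some (.inr (i, i)))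

theorem jetLaplacian_apply (x : L2Family Ω (Option (Fin d ⊕ Fin d × Fin d))) :
    jetLaplacian Ω x = ∑ i, x (some (.inr (i, i))) := by
  simp [jetLaplacian]

/-- The bilinear form of the primal formulation, on second order jets. -/
noncomputable def energyForm (Ω : Set (Euc d)) (ε : ℝ) :
    L2Family Ω (Option (Fin d ⊕ Fin d × Fin d)) →L[ℝ]
      L2Family Ω (Option (Fin d ⊕ Fin d × Fin d)) →L[ℝ] ℝ :=
  let I := (isBoundedBilinearMap_inner (𝕜 := ℝ) (E := Lp ℝ 2 (volOn Ω))).toContinuousLinearMap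
  ε ^ 2 • I.bilinearComp (jetLaplacian Ω) (jetLaplacian Ω) +
    ∑ i, I.bilinearComp (PiLp.proj 2 _ (some (.inl i))) (PiLp.proj 2 _ (some (.inl i)))

theorem energyForm_apply (ε : ℝ) (x y : L2Family Ω (Option (Fin d ⊕ Fin d × Fin d))) :
    energyForm Ω ε x y = ε ^ 2 * inner ℝ (jetLaplacian Ω x) (jetLaplacian Ω y) +
      ∑ i, inner ℝ (x (some (.inl i))) (y (some (.inl i))) := by
  simp [energyForm]

theorem coeFn_sum_ae_eq {ι : Type*} (s : Finset ι) {x : ι → Lp ℝ 2 (volOn Ω)}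
    {g : ι → Euc d → ℝ} (h : ∀ i ∈ s, g i =ᵐ[volOn Ω] x i) :
    (fun y => ∑ i ∈ s, g i y) =ᵐ[volOn Ω] (∑ i ∈ s, x i : Lp ℝ 2 (volOn Ω)) := by
  classical
  induction s using Finset.induction_on with
  | empty =>
    simp only [Finset.sum_empty]
    exact (Lp.coeFn_zero ℝ 2 (volOn Ω)).symm
  | insert a s ha ih =>
    rw [Finset.sum_insert ha]
    filter_upwards [Lp.coeFn_add (x a) (∑ i ∈ s, x i), h a (Finset.mem_insert_self a s),
      ih fun i hi => h i (Finset.mem_insert_of_mem hi)] with y h1 h2 h3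
    rw [Finset.sum_insert ha, h1, Pi.add_apply, h2, h3]

theorem weakLaplacian_ae_eq {u : Euc d → ℝ} {x : L2Family Ω (Option (Fin d ⊕ Fin d × Fin d))}
    (hx : ∀ k, x k =ᵐ[volOn Ω] iterWeakPartial Ω (secondOrder k) u) :
    weakLaplacian Ω u =ᵐ[volOn Ω] jetLaplacian Ω x := by
  rw [jetLaplacian_apply]
  exact coeFn_sum_ae_eq _ fun i _ => (hx (some (.inr (i, i)))).symm

theorem energyForm_eq (ε : ℝ) {u v : Euc d → ℝ}
    {x y : L2Family Ω (Option (Fin d ⊕ Fin d × Fin d))}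
    (hx : ∀ k, x k =ᵐ[volOn Ω] iterWeakPartial Ω (secondOrder k) u)
    (hy : ∀ k, y k =ᵐ[volOn Ω] iterWeakPartial Ω (secondOrder k) v) :
    ε ^ 2 * innerL2 Ω (weakLaplacian Ω u) (weakLaplacian Ω v) + innerGrad Ω u v =
      energyForm Ω ε x y := by
  rw [energyForm_apply, innerL2_eq_inner (weakLaplacian_ae_eq hx) (weakLaplacian_ae_eq hy)]
  congr 1
  exact Finset.sum_congr rfl fun i _ =>
    innerL2_eq_inner (hx (some (.inl i))).symm (hy (some (.inl i))).symm

/-- The Hessian is controlled by the Laplacian under clamped boundary conditions. -/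
theorem sum_norm_sq_eq_jetLaplacian {x : L2Family Ω (Option (Fin d ⊕ Fin d × Fin d))}
    (hx : x ∈ sobolevJets Ω secondOrder) :
    ∑ p : Fin d × Fin d, ‖x (some (.inr p))‖ ^ 2 = ‖jetLaplacian Ω x‖ ^ 2 := by
  have key : ∀ i j, inner ℝ (x (some (.inr (i, j)))) (x (some (.inr (i, j)))) =
      inner ℝ (x (some (.inr (i, i)))) (x (some (.inr (j, j)))) := by
    intro i j
    refine sobolevJets_induction (p := fun x => inner ℝ (x (some (.inr (i, j))))
      (x (some (.inr (i, j)))) = inner ℝ (x (some (.inr (i, i)))) (x (some (.inr (j, j)))))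
      ?_ (fun x φ hφ hxφ => ?_) hx
    · have hc (k l : Option (Fin d ⊕ Fin d × Fin d)) :
          Continuous fun x : L2Family Ω (Option (Fin d ⊕ Fin d × Fin d)) =>
            (inner ℝ (x k) (x l) : ℝ) :=
        (continuous_L2Family_apply k).inner (continuous_L2Family_apply l)
      exact isClosed_eq (hc (some (.inr (i, j))) (some (.inr (i, j))))
        (hc (some (.inr (i, i))) (some (.inr (j, j))))
    · have h : ∀ k l, x (some (.inr (k, l))) =ᵐ[volOn Ω] pderiv l (pderiv k φ) :=
        fun k l => hxφ (some (.inr (k, l)))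
      rw [← innerL2_coe, ← innerL2_coe,
        innerL2_congr (h i j) (h i j), innerL2_congr (h i i) (h j j)]
      exact innerL2_pderiv_pderiv hφ i j
  rw [jetLaplacian_apply, ← real_inner_self_eq_norm_sq, sum_inner, Fintype.sum_prod_type]
  simp only [inner_sum]
  exact Finset.sum_congr rfl fun i _ => Finset.sum_congr rfl fun j _ =>
    (real_inner_self_eq_norm_sq _).symm.trans (key i j)

theorem exists_abs_apply_le (hbdd : Bornology.IsBounded Ω) :
    ∃ R : ℝ, ∀ i : Fin d, ∀ x ∈ Ω, |x i| ≤ R := by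
  obtain ⟨R, hR⟩ := hbdd.exists_norm_le
  exact ⟨R, fun i x hx => (PiLp.norm_apply_le x i).trans (hR x hx)⟩

theorem energyForm_self (ε : ℝ) (x : L2Family Ω (Option (Fin d ⊕ Fin d × Fin d))) :
    energyForm Ω ε x x = ε ^ 2 * ‖jetLaplacian Ω x‖ ^ 2 + ∑ i, ‖x (some (.inl i))‖ ^ 2 := by
  simp only [energyForm_apply, real_inner_self_eq_norm_sq]

theorem norm_sq_of_mem_sobolevJets {x : L2Family Ω (Option (Fin d ⊕ Fin d × Fin d))}
    (hx : x ∈ sobolevJets Ω secondOrder) :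
    ‖x‖ ^ 2 = ‖x none‖ ^ 2 + (∑ i, ‖x (some (.inl i))‖ ^ 2 + ‖jetLaplacian Ω x‖ ^ 2) := by
  rw [PiLp.norm_sq_eq_of_L2, Fintype.sum_option, Fintype.sum_sum_type,
    sum_norm_sq_eq_jetLaplacian hx]

/-- In the squared norm of a jet, Poincaré in one direction bounds the zeroth-order part by the
gradient part, and the Hessian part equals that of the Laplacian. The term $1/\varepsilon^2$ in the
constant pays for the Laplacian, and $4R^2+1$ for the function and its gradient. -/
theorem energyForm_coercive (hd : 0 < d) (hbdd : Bornology.IsBounded Ω) {ε : ℝ} (hε : 0 < ε) :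
    ∃ C, 0 < C ∧ ∀ x ∈ sobolevJets Ω (secondOrder (d := d)),
      C * ‖x‖ * ‖x‖ ≤ energyForm Ω ε x x := by
  obtain ⟨R, hR⟩ := exists_abs_apply_le hbdd
  have hM0 : 0 < 4 * R ^ 2 + 1 + 1 / ε ^ 2 := by positivity
  refine ⟨(4 * R ^ 2 + 1 + 1 / ε ^ 2)⁻¹, by positivity, fun x hx => ?_⟩
  have h1 := inner_self_le_of_mem_sobolevJets hx (k := none)
    (k' := some (.inl ⟨0, hd⟩)) rfl rfl (hR ⟨0, hd⟩)
  have h3 : ‖x (some (.inl ⟨0, hd⟩))‖ ^ 2 ≤ ∑ i, ‖x (some (.inl i))‖ ^ 2 :=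
    Finset.single_le_sum (f := fun i => ‖x (some (.inl i))‖ ^ 2) (fun i _ => sq_nonneg _)
      (Finset.mem_univ _)
  have h4 := h1.trans (mul_le_mul_of_nonneg_left h3 (by positivity))
  have hG0 := (sq_nonneg _).trans h3
  have hL0 : 0 ≤ ‖jetLaplacian Ω x‖ ^ 2 := sq_nonneg _
  rw [mul_assoc, ← sq ‖x‖, norm_sq_of_mem_sobolevJets hx, energyForm_self, inv_mul_le_iff₀ hM0]
  generalize ∑ i, ‖x (some (.inl i))‖ ^ 2 = G at *
  generalize ‖jetLaplacian Ω x‖ ^ 2 = L at *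
  have h5 : (4 * R ^ 2 + 1 + 1 / ε ^ 2) * (ε ^ 2 * L + G) =
      L + 4 * R ^ 2 * G + G + ((4 * R ^ 2 + 1) * (ε ^ 2 * L) + 1 / ε ^ 2 * G) := by
    field_simp
    ring
  rw [h5]
  have : 0 ≤ (4 * R ^ 2 + 1) * (ε ^ 2 * L) + 1 / ε ^ 2 * G := by positivity
  linarith

theorem IsPrimalSolution.ae_eq (hd : 0 < d) (hbdd : Bornology.IsBounded Ω) {ε : ℝ} (hε : 0 < ε)
    {f w w' : Euc d → ℝ} (hw : IsPrimalSolution Ω ε f w) (hw' : IsPrimalSolution Ω ε f w') :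
    w =ᵐ[volOn Ω] w' := by
  obtain ⟨C, hC, hcoer⟩ := energyForm_coercive hd hbdd hε
  have hx := weakJet_ae_eq (m := secondOrder) hw.1.1.memLp
  have hy := weakJet_ae_eq (m := secondOrder) hw'.1.1.memLp
  set x := weakJet secondOrder w hw.1.1.memLp
  set y := weakJet secondOrder w' hw'.1.1.memLp
  have e1 := hw.2 w hw.1
  have e2 := hw.2 w' hw'.1
  have e3 := hw'.2 w hw.1
  have e4 := hw'.2 w' hw'.1
  rw [energyForm_eq ε hx hx] at e1
  rw [energyForm_eq ε hx hy] at e2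
  rw [energyForm_eq ε hy hx] at e3
  rw [energyForm_eq ε hy hy] at e4
  -- Expanding bilinearly, the equations for `w` and `w'`, each tested with both functions, cancel
  -- in pairs.
  have h0 : energyForm Ω ε (x - y) (x - y) = 0 := by
    simp only [map_sub, sub_apply]
    linarith
  have h1 := hcoer (x - y) (Submodule.sub_mem _ hw.1.weakJet_mem hw'.1.weakJet_mem)
  rw [h0, mul_assoc] at h1
  have h2 : ‖x - y‖ = 0 := by
    have := nonpos_of_mul_nonpos_right h1 hC
    nlinarith [norm_nonneg (x - y)]
  have h3 : x = y := sub_eq_zero.1 (norm_eq_zero.1 h2)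
  rw [h3] at hx
  exact (hx none).symm.trans (hy none)

theorem exists_isPrimalSolution (hd : 0 < d) (hΩ : IsOpen Ω) (hbdd : Bornology.IsBounded Ω)
    {ε : ℝ} (hε : 0 < ε) {f : Euc d → ℝ} (hf : MemLp f 2 (volOn Ω)) :
    ∃ w, IsPrimalSolution Ω ε f w := by
  obtain ⟨C, hC, hcoer⟩ := energyForm_coercive hd hbdd hε
  let W := sobolevJets Ω (secondOrder (d := d))
  have : CompleteSpace W := (Submodule.isClosed_topologicalClosure _).completeSpace_coe
  let B : W →L[ℝ] W →L[ℝ] ℝ := (energyForm Ω ε).bilinearComp W.subtypeL W.subtypeL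
  have hB : IsCoercive B := ⟨C, hC, fun x => hcoer x x.2⟩
  -- The load $v\mapsto(f,v)$ sees only the zeroth component. Its Riesz representative is then
  -- pulled back through the Lax–Milgram isomorphism.
  let ℓ : W →L[ℝ] ℝ := (innerSL ℝ (hf.toLp f)).comp
    ((PiLp.proj 2 (𝕜 := ℝ) (fun _ => Lp ℝ 2 (volOn Ω)) none).comp W.subtypeL)
  let x := hB.continuousLinearEquivOfBilin.symm ((InnerProductSpace.toDual ℝ W).symm ℓ)
  have hx : ∀ y : W, energyForm Ω ε x y = inner ℝ (hf.toLp f) (y.1 none) := by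
    intro y
    change B x y = ℓ y
    rw [← hB.continuousLinearEquivOfBilin_apply, ContinuousLinearEquiv.apply_symm_apply,
      InnerProductSpace.toDual_symm_apply]
  refine ⟨x.1 none, memH20_of_mem_sobolevJets hΩ x.2, fun v hv => ?_⟩
  rw [energyForm_eq ε (iterWeakPartial_ae_eq_of_mem_sobolevJets hΩ x.2)
    (weakJet_ae_eq (m := secondOrder) hv.1.memLp), hx ⟨_, hv.weakJet_mem⟩]
  exact (innerL2_eq_inner hf.coeFn_toLp.symm (weakJet_ae_eq hv.1.memLp none).symm).symm

end Energy

/-! ### The mixed problem: uniqueness and comparison with the primal one. -/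

section Mixed

variable {d : ℕ} {Ω : Set (Euc d)}

theorem innerGrad_eq {u v : Euc d → ℝ} (hu : MemH1 Ω u) (hv : MemH1 Ω v) :
    innerGrad Ω u v = ∑ i, inner ℝ (weakJet firstOrder u hu.memLp (some i))
      (weakJet firstOrder v hv.memLp (some i)) :=
  Finset.sum_congr rfl fun i _ => innerL2_eq_inner
    (weakJet_ae_eq hu.memLp (some i)).symm (weakJet_ae_eq hv.memLp (some i)).symm

theorem innerL2_eq_weakJet {u v : Euc d → ℝ} (hu : MemH1 Ω u) (hv : MemH1 Ω v) :
    innerL2 Ω u v = inner ℝ (weakJet firstOrder u hu.memLp none)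
      (weakJet firstOrder v hv.memLp none) :=
  innerL2_eq_inner (weakJet_ae_eq hu.memLp none).symm (weakJet_ae_eq hv.memLp none).symm

theorem IsMixedSolution.ae_eq (hd : 0 < d) (hbdd : Bornology.IsBounded Ω) {ε : ℝ} (hε : 0 < ε)
    {f ψ u ψ' u' : Euc d → ℝ} (h : IsMixedSolution Ω ε f ψ u)
    (h' : IsMixedSolution Ω ε f ψ' u') : ψ' =ᵐ[volOn Ω] ψ ∧ u' =ᵐ[volOn Ω] u := by
  obtain ⟨hψ, hu, h1, h2⟩ := h
  obtain ⟨hψ', hu', h1', h2'⟩ := h'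
  -- Each equation is tested with the individual functions; the differences are formed later, in the
  -- jets, by bilinearity.
  have a1 := h1 u hu
  have a2 := h1 u' hu'
  have a3 := h1' u hu
  have a4 := h1' u' hu'
  have b1 := h2 ψ hψ
  have b2 := h2 ψ' hψ'
  have b3 := h2' ψ hψ
  have b4 := h2' ψ' hψ'
  have c1 := h2 u hu.1
  have c2 := h2 u' hu'.1
  have c3 := h2' u hu.1
  have c4 := h2' u' hu'.1
  have jψ := weakJet_ae_eq (m := firstOrder) hψ.memLp none
  have jψ' := weakJet_ae_eq (m := firstOrder) hψ'.memLp none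
  have ju := weakJet_ae_eq (m := firstOrder) hu.1.memLp none
  have ju' := weakJet_ae_eq (m := firstOrder) hu'.1.memLp none
  rw [innerGrad_eq hψ hu.1, innerL2_eq_weakJet hψ hu.1] at a1
  rw [innerGrad_eq hψ hu'.1, innerL2_eq_weakJet hψ hu'.1] at a2
  rw [innerGrad_eq hψ' hu.1, innerL2_eq_weakJet hψ' hu.1] at a3
  rw [innerGrad_eq hψ' hu'.1, innerL2_eq_weakJet hψ' hu'.1] at a4
  rw [innerGrad_eq hu.1 hψ, innerL2_eq_weakJet hψ hψ] at b1
  rw [innerGrad_eq hu.1 hψ', innerL2_eq_weakJet hψ hψ'] at b2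
  rw [innerGrad_eq hu'.1 hψ, innerL2_eq_weakJet hψ' hψ] at b3
  rw [innerGrad_eq hu'.1 hψ', innerL2_eq_weakJet hψ' hψ'] at b4
  rw [innerGrad_eq hu.1 hu.1, innerL2_eq_weakJet hψ hu.1] at c1
  rw [innerGrad_eq hu.1 hu'.1, innerL2_eq_weakJet hψ hu'.1] at c2
  rw [innerGrad_eq hu'.1 hu.1, innerL2_eq_weakJet hψ' hu.1] at c3
  rw [innerGrad_eq hu'.1 hu'.1, innerL2_eq_weakJet hψ' hu'.1] at c4
  have hmem := Submodule.sub_mem _ hu'.weakJet_mem hu.weakJet_mem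
  set U := weakJet firstOrder u hu.1.memLp
  set U' := weakJet firstOrder u' hu'.1.memLp
  set P := weakJet firstOrder ψ hψ.memLp
  set P' := weakJet firstOrder ψ' hψ'.memLp
  have A : ε ^ 2 * ∑ i, inner ℝ ((P' - P) (some i)) ((U' - U) (some i)) +
      inner ℝ ((P' - P) none) ((U' - U) none) = 0 := by
    simp only [PiLp.sub_apply, inner_sub_left, inner_sub_right, Finset.sum_sub_distrib]
    linarith
  have B : ∑ i, inner ℝ ((P' - P) (some i)) ((U' - U) (some i)) = ‖(P' - P) none‖ ^ 2 := by
    rw [← real_inner_self_eq_norm_sq]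
    simp only [real_inner_comm ((U' - U) _)]
    simp only [PiLp.sub_apply, inner_sub_left, inner_sub_right, Finset.sum_sub_distrib]
    linarith
  have D : ∑ i, ‖(U' - U) (some i)‖ ^ 2 = inner ℝ ((P' - P) none) ((U' - U) none) := by
    simp only [← real_inner_self_eq_norm_sq]
    simp only [PiLp.sub_apply, inner_sub_left, inner_sub_right, Finset.sum_sub_distrib]
    linarith
  -- The cross terms are eliminated: `A` becomes $\varepsilon^2\|P'-P\|^2+\|\nabla(U'-U)\|^2=0$, a
  -- sum of nonnegative terms.
  rw [B, ← D] at A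
  have hS : 0 ≤ ∑ i, ‖(U' - U) (some i)‖ ^ 2 := Finset.sum_nonneg fun i _ => sq_nonneg _
  have hP0 : ‖(P' - P) none‖ ^ 2 = 0 := by
    have : ε ^ 2 * ‖(P' - P) none‖ ^ 2 = 0 := by
      have : 0 ≤ ε ^ 2 * ‖(P' - P) none‖ ^ 2 := by positivity
      linarith
    simpa [hε.ne'] using this
  have hU0 : ‖(U' - U) (some ⟨0, hd⟩)‖ ^ 2 = 0 := by
    rw [hP0, mul_zero, zero_add, Finset.sum_eq_zero_iff_of_nonneg fun i _ => sq_nonneg _] at A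
    exact A _ (Finset.mem_univ _)
  obtain ⟨R, hR⟩ := exists_abs_apply_le hbdd
  have hpoin := inner_self_le_of_mem_sobolevJets hmem (k := none) (k' := some ⟨0, hd⟩) rfl rfl
    (hR ⟨0, hd⟩)
  rw [hU0, mul_zero] at hpoin
  have eP : P' none = P none := by
    have : (P' - P) none = 0 := by simpa using hP0
    exact sub_eq_zero.1 this
  have eU : U' none = U none := by
    have : (U' - U) none = 0 := norm_eq_zero.1 (pow_eq_zero_iff two_ne_zero |>.1
      (le_antisymm hpoin (sq_nonneg _)))
    exact sub_eq_zero.1 this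
  exact ⟨jψ'.symm.trans (eP ▸ jψ), ju'.symm.trans (eU ▸ ju)⟩

/-- The second equation of the mixed formulation identifies `ψ` with `-Δu`. -/
theorem IsMixedSolution.weakLaplacian_ae_eq (hΩ : IsOpen Ω) {ε : ℝ} {f ψ u : Euc d → ℝ}
    (h : IsMixedSolution Ω ε f ψ u) (hu : MemH2 Ω u) :
    weakLaplacian Ω u =ᵐ[volOn Ω] fun x => -ψ x := by
  have hm : ∀ i, IsWeakPartial Ω i (weakPartial Ω i u) (weakPartial Ω i (weakPartial Ω i u)) :=
    fun i => isWeakPartial_weakPartial ((hu.2 i).2 i)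
  refine ae_eq_of_forall_innerL2 hΩ (memLp_finsetSum _ fun i _ => (hm i).1) h.1.1.neg
    fun φ hφ => ?_
  -- Test functions suffice to identify the Laplacian.
  have e := h.2.2.2 φ hφ.memH1
  have e1 : innerGrad Ω u φ = - innerL2 Ω (weakLaplacian Ω u) φ := by
    have : ∀ i, innerL2 Ω (weakPartial Ω i u) (weakPartial Ω i φ) =
        - innerL2 Ω (weakPartial Ω i (weakPartial Ω i u)) φ := fun i => by
      rw [innerL2_congr ae_eq_rfl ((hφ.isWeakPartial i).weakPartial_ae_eq hΩ)]
      exact (hm i).2 φ hφ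
    simp only [innerGrad, this, Finset.sum_neg_distrib, neg_inj]
    simp only [innerL2, weakLaplacian, Finset.sum_mul]
    exact (integral_finsetSum _ fun i _ => (hm i).1.integrable_mul (hφ.memLp 2)).symm
  have e2 : innerL2 Ω (fun x => -ψ x) φ = - innerL2 Ω ψ φ := by
    simp only [innerL2, neg_mul, integral_neg]
  rw [e2, ← e, e1, neg_neg]

/-- Green's formula for `ψ ∈ H¹(Ω)` and `v ∈ H²₀(Ω)`. -/
theorem innerL2_weakLaplacian {ψ v : Euc d → ℝ} (hψ : MemH1 Ω ψ)
    (hv : MemH20 Ω v) : innerL2 Ω ψ (weakLaplacian Ω v) = - innerGrad Ω ψ v := by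
  have hx := weakJet_ae_eq (m := secondOrder) hv.1.memLp
  have hp := weakJet_ae_eq (m := firstOrder) hψ.memLp
  set P := weakJet firstOrder ψ hψ.memLp
  -- For a test function $\varphi$ in place of $v$, this is the definition of the weak derivative of
  -- $\psi$ applied to $\partial_i\varphi$. Density in $H^2_0$ does the rest, without any boundary
  -- condition on $\psi$.
  have key : ∀ i, inner ℝ (P none) (weakJet secondOrder v hv.1.memLp (some (.inr (i, i)))) =
      - inner ℝ (P (some i)) (weakJet secondOrder v hv.1.memLp (some (.inl i))) := by
    intro i
    refine sobolevJets_induction (p := fun x => inner ℝ (P none) (x (some (.inr (i, i)))) =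
      - inner ℝ (P (some i)) (x (some (.inl i)))) ?_ (fun x φ hφ hxφ => ?_) hv.weakJet_mem
    · exact isClosed_eq (continuous_const.inner (continuous_L2Family_apply _))
        (continuous_const.inner (continuous_L2Family_apply _)).neg
    · rw [← innerL2_coe, ← innerL2_coe, innerL2_congr (hp none) (hxφ _),
        innerL2_congr (hp (some i)) (hxφ _)]
      exact (isWeakPartial_weakPartial (hψ.2 i)).2 _ (hφ.pderiv i)
  have hp0 : ψ =ᵐ[volOn Ω] P none := (hp none).symm
  rw [innerL2_eq_inner hp0 (_root_.weakLaplacian_ae_eq hx), jetLaplacian_apply,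
    inner_sum, Finset.sum_congr rfl fun i _ => key i, Finset.sum_neg_distrib, neg_inj]
  exact Finset.sum_congr rfl fun i _ =>
    (innerL2_eq_inner (hp (some i)).symm (hx (some (.inl i))).symm).symm

theorem IsMixedSolution.isPrimalSolution (hΩ : IsOpen Ω) {ε : ℝ} {f ψ u : Euc d → ℝ}
    (h : IsMixedSolution Ω ε f ψ u) (hu : MemH20 Ω u) : IsPrimalSolution Ω ε f u := by
  refine ⟨hu, fun v hv => ?_⟩
  have e1 := h.2.2.1 v hv.memH10
  have e2 := h.2.2.2 v hv.1.1
  have e3 : innerL2 Ω (weakLaplacian Ω u) (weakLaplacian Ω v) = innerGrad Ω ψ v := by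
    rw [innerL2_congr (h.weakLaplacian_ae_eq hΩ hu.1) ae_eq_rfl]
    have : innerL2 Ω (fun x => -ψ x) (weakLaplacian Ω v) = - innerL2 Ω ψ (weakLaplacian Ω v) := by
      simp only [innerL2, neg_mul, integral_neg]
    rw [this, innerL2_weakLaplacian h.1 hv, neg_neg]
  rw [e3, e2, e1]

end Mixed

theorem theorem2p2 (d : ℕ) (hd : d = 2 ∨ d = 3) (Ω : Set (Euc d)) (hΩ : IsOpen Ω)
    (hbdd : Bornology.IsBounded Ω) (ε : ℝ) (hε : 0 < ε) (f : Euc d → ℝ)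
    (hf : MemLp f 2 (volOn Ω)) :
    (∃ w : Euc d → ℝ, IsPrimalSolution Ω ε f w ∧
      ∀ w' : Euc d → ℝ, IsPrimalSolution Ω ε f w' → w' =ᵐ[volOn Ω] w) ∧
    (∀ ψ u ψ' u' : Euc d → ℝ, IsMixedSolution Ω ε f ψ u → IsMixedSolution Ω ε f ψ' u' →
      ψ' =ᵐ[volOn Ω] ψ ∧ u' =ᵐ[volOn Ω] u) ∧
    ∀ w ψ u : Euc d → ℝ, IsPrimalSolution Ω ε f w → IsMixedSolution Ω ε f ψ u →
      (w =ᵐ[volOn Ω] u ↔ MemH20 Ω u) := by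
  have hd0 : 0 < d := by omega
  obtain ⟨w, hw⟩ := exists_isPrimalSolution hd0 hΩ hbdd hε hf
  refine ⟨⟨w, hw, fun w' hw' => hw'.ae_eq hd0 hbdd hε hw⟩,
    fun ψ u ψ' u' h h' => h.ae_eq hd0 hbdd hε h', fun w ψ u hw h =>
    ⟨fun hwu => hw.1.congr hwu, fun hu => hw.ae_eq hd0 hbdd hε (h.isPrimalSolution hΩ hu)⟩⟩
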